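/- Let $k$ be an algebraically closed field of characteristic $p\ge 0$, let $R=k[X_0,X_1,X_2]$, and let $I\subset R$ be an ideal of codimension (height) $2$ generated by a minimal generating set $f_0,\dots,f_3$ of homogeneous polynomials of the same degree $d$. Let $J(\mathbf f)=(\partial f_i/\partial X_j)$ be the $4\times 3$ Jacobian matrix and let $I_3(J(\mathbf f))$ be the ideal generated by its $3\times 3$ minors. Assume that $I_3(J(\mathbf f))\neq 0$ and that $p$ does not divide $d$. Let $\Gamma\subset\mathbb P^2_k\times\mathbb P^3_k$ be the closure of the graph of the rational map $\phi=(f_0:\dots:f_3):\mathbb P^2_k\dashrightarrow\mathbb P^3_k$; it is defined by the Rees algebra $\mathcal R_I=\bigoplus_{s\ge 0}I^s$, regarded as a quotient of $R[T_0,\dots,T_3]$ via $T_i\mapsto f_i$. Let $\pi:\Gamma\to\mathbb P^3_k$ be the projection. For a closed point $y\in\mathbb P^3_k$ the fiber is $\pi^{-1}(y)=\operatorname{Proj}(\mathcal R_I\otimes_{k[T_0,\dots,T_3]}k(y))\subset\mathbb P^2_k$. Let $\mathcal Y_1$ be the set of closed points $y\in\mathbb P^3_k$ with $\dim\pi^{-1}(y)=1$.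 Let $\operatorname{Syz}(I)=\{(a_0,\dots,a_3)\in R^4 : \sum_i a_if_i=0\}$, graded so that its component $\operatorname{Syz}(I)_\nu$ consists of the syzygies whose entries are forms of degree $\nu$, and let $\operatorname{indeg}(\operatorname{Syz}(I))=\inf\{\nu : \operatorname{Syz}(I)_\nu\neq 0\}$. Then $\mathcal Y_1$ is finite; for each $y\in\mathcal Y_1$ the unmixed one-dimensional part of $\pi^{-1}(y)$ is defined by a nonzero homogeneous polynomial $h_y\in R$ (unique up to a nonzero scalar); $\operatorname{indeg}(\operatorname{Syz}(I))$ is finite; and $$\sum_{y\in\mathcal Y_1}\deg h_y\;\le\;3(d-1)-\operatorname{indeg}(\operatorname{Syz}(I))\;<\;3(d-1).$$ -/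

import Mathlib

namespace RationalMapFibers

noncomputable section

open MvPolynomial LinearAlgebra.Projectivization

attribute [local instance] MvPolynomial.gradedAlgebra

/-- The ideal `I_s(M)` generated by the `s × s` minors of a matrix `M`. -/
def minorsIdeal {m n R : Type*} [CommRing R] (s : ℕ) (M : Matrix m n R) : Ideal R :=
  Ideal.span (Set.range fun rc : (Fin s ↪ m) × (Fin s ↪ n) => (M.submatrix rc.1 rc.2).det)

variable {k : Type*} [Field k] {σ ι : Type*}

/-- The base ideal `I = (f_i)`. -/
def baseIdeal (f : ι → MvPolynomial σ k) : Ideal (MvPolynomial σ k) :=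
  Ideal.span (Set.range f)

/-- The `f_i` are a minimal generating set of `I`: no `f_i` lies in the ideal generated by the
others, so no generator can be dropped. -/
def IsMinimalGeneratingSet (f : ι → MvPolynomial σ k) : Prop :=
  ∀ i, f i ∉ Ideal.span (f '' {i}ᶜ)

/-- The Jacobian matrix `J(f)`, with entry `∂ f_i / ∂ X_j` in row `i` and column `j`. -/
def jacobian (f : ι → MvPolynomial σ k) : Matrix ι σ (MvPolynomial σ k) :=
  Matrix.of fun i j => pderiv j (f i)

/-- The defining ideal of the Rees algebra of `I` (hence of the closure `Γ` of the graph of `φ`):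
with `R = k[X]`, it is the kernel of `R[T] → R[t]`, `T_i ↦ f_i t`, whose image is
`⨁ I ^ s t ^ s`. -/
def reesIdeal (f : ι → MvPolynomial σ k) : Ideal (MvPolynomial ι (MvPolynomial σ k)) :=
  RingHom.ker (aeval fun i => Polynomial.C (f i) * Polynomial.X :
    MvPolynomial ι (MvPolynomial σ k) →ₐ[MvPolynomial σ k] Polynomial (MvPolynomial σ k))

/-- The specialization `R[T] → R`, `T_i ↦ p_i`, at a vector `p` of scalars. -/
def specialize (p : ι → k) : MvPolynomial ι (MvPolynomial σ k) →+* MvPolynomial σ k :=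
  eval fun i => C (p i)

/-- The ideal of `R` obtained by specializing the Rees ideal at `T = p`. Writing the Rees algebra
as `R[T] / reesIdeal f`, the quotient of `R` by this ideal is the tensor product over `k[T]` of
the Rees algebra with `k`, where `T_i` acts on `k` as `p_i`. -/
def specializedIdeal (f : ι → MvPolynomial σ k) (p : ι → k) : Ideal (MvPolynomial σ k) :=
  (reesIdeal f).map (specialize p)

/-- The specialized ideal depends only on the point of projective space. -/
theorem specializedIdeal_smul_le (f : ι → MvPolynomial σ k) (p : ι → k) (t : k) :
    specializedIdeal f (t • p) ≤ specializedIdeal f p := by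
  unfold specializedIdeal
  rw [Ideal.map_le_iff_le_comap]
  intro G hG
  rw [Ideal.mem_comap]
  let τ : MvPolynomial ι (MvPolynomial σ k) →ₐ[MvPolynomial σ k]
      MvPolynomial ι (MvPolynomial σ k) := aeval fun i => C (C t) * X i
  have h1 : specialize (t • p) G = specialize p (τ G) := by
    have : (specialize (t • p) : MvPolynomial ι (MvPolynomial σ k) →+* _)
        = (specialize p).comp τ.toRingHom := by
      apply MvPolynomial.ringHom_ext
      · intro r; simp [specialize, τ]
      · intro i; simp [specialize, τ]
    rw [this]; rfl
  rw [h1]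
  apply Ideal.mem_map_of_mem
  have h0 : (aeval fun i => Polynomial.C (f i) * Polynomial.X :
      MvPolynomial ι (MvPolynomial σ k) →ₐ[MvPolynomial σ k] Polynomial (MvPolynomial σ k)) G
      = 0 := hG
  change (aeval fun i => Polynomial.C (f i) * Polynomial.X :
      MvPolynomial ι (MvPolynomial σ k) →ₐ[MvPolynomial σ k] Polynomial (MvPolynomial σ k)) (τ G)
      = 0
  have h2 : (aeval fun i => Polynomial.C (f i) * Polynomial.X :
      MvPolynomial ι (MvPolynomial σ k) →ₐ[MvPolynomial σ k] Polynomial (MvPolynomial σ k)).comp τ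
      = (Polynomial.aeval (Polynomial.C (C t) * Polynomial.X)).comp
        (aeval fun i => Polynomial.C (f i) * Polynomial.X) := by
    apply MvPolynomial.algHom_ext
    intro i
    simp [τ]
    ring
  have h3 := DFunLike.congr_fun h2 G
  simp only [AlgHom.comp_apply] at h3
  rw [h3, h0, map_zero]

/-- The homogeneous ideal defining the fiber `π⁻¹(y) = Proj (Rees(I) ⊗ k(y))` as a closed
subscheme of the projective space with coordinate ring `R`, for a closed point `y`
(a point with coordinates in `k`) of the target projective space. -/
def fiberIdeal (f : ι → MvPolynomial σ k) (y : ℙ k (ι → k)) : Ideal (MvPolynomial σ k) :=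
  Projectivization.lift (fun p : {v : ι → k // v ≠ 0} => specializedIdeal f p.1)
    (by
      rintro ⟨a, ha⟩ ⟨b, hb⟩ t h
      simp only at h
      subst h
      have ht : t ≠ 0 := fun h => ha (by simp [h])
      refine le_antisymm (specializedIdeal_smul_le f b t) ?_
      have := specializedIdeal_smul_le f (t • b) t⁻¹
      rwa [smul_smul, inv_mul_cancel₀ ht, one_smul] at this) y

/-- The underlying topological space of the fiber `π⁻¹(y)`, as a closed subset of
`Proj R`. -/
def fiber (f : ι → MvPolynomial σ k) (y : ℙ k (ι → k)) :
    Set (ProjectiveSpectrum (homogeneousSubmodule σ k)) :=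
  ProjectiveSpectrum.zeroLocus (homogeneousSubmodule σ k) (fiberIdeal f y)

/-- The set `𝒴_ℓ` of the closed points of the target whose fiber has dimension `ℓ`. -/
def pointsWithFiberDim (f : ι → MvPolynomial σ k) (ℓ : ℕ) : Set (ℙ k (ι → k)) :=
  {y | topologicalKrullDim (fiber f y) = ℓ}

/-- The unmixed part (of maximal dimension) of an ideal `J`: the intersection of the primary
components of `J` at its primes `P` of minimal height, the `P`-primary component being the
contraction of the extension of `J` to the localization at `P`. -/
def unmixedPart {R : Type*} [CommRing R] (J : Ideal R) : Ideal R :=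
  ⨅ P : {P : PrimeSpectrum R // P.asIdeal ∈ J.minimalPrimes ∧ P.asIdeal.height = J.height},
    (J.map (algebraMap R (Localization.AtPrime P.1.asIdeal))).comap
      (algebraMap R (Localization.AtPrime P.1.asIdeal))

/-- `h` is a defining equation of the unmixed part of the fiber `π⁻¹(y)`. -/
def IsUnmixedEquation (f : ι → MvPolynomial σ k) (y : ℙ k (ι → k)) (h : MvPolynomial σ k) :
    Prop :=
  Ideal.span {h} = unmixedPart (fiberIdeal f y)

/-- The degree `ν` part of `Syz(I) ⊆ R ^ (n + 1)`: the tuples `a` of forms of degree `ν` such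
that `∑ a_i f_i = 0`. -/
def syzygyPart [Fintype ι] (f : ι → MvPolynomial σ k) (ν : ℕ) :
    Submodule k (ι → MvPolynomial σ k) :=
  (LinearMap.ker (Fintype.linearCombination (MvPolynomial σ k) f)).restrictScalars k ⊓
    Submodule.pi Set.univ fun _ => homogeneousSubmodule σ k ν

/-- The initial degree of a graded module with components `M ν`: the infimum of the degrees `ν`
with `M ν ≠ 0`, equal to `⊤` if there is none. -/
def indeg {V : Type*} [AddCommGroup V] [Module k V] (M : ℕ → Submodule k V) : ℕ∞ :=
  ⨅ ν ∈ {ν : ℕ | M ν ≠ ⊥}, (ν : ℕ∞)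

end

end RationalMapFibers

open RationalMapFibers

/-!
Linear combinations of the `f i` cut out the fibers: `y_i f_j - y_j f_i` lies in the fiber ideal of
`y`. Hence an equation `h` of the codimension-one part of the fiber divides these forms, so that
`f_i = c_i f_m + h g_i` with scalars `c_i`. Differentiating, the Jacobian matrix has rank at most
two modulo `h`, and therefore its maximal minors, of size `ℓ + 2`, are divisible by `h ^ ℓ`. The
Plücker relations show that a common divisor of the equations at two distinct points divides all
the `f_i` once their greatest common divisor is removed, so distinct equations are coprime and
`∏ h_y ^ ℓ` divides every maximal minor. By Euler's formula the signed minors form a syzygy of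
degree `(ℓ + 2)(d - 1)`; dividing it by the product leaves a nonzero syzygy, whose degree is at
least the initial degree.
-/

namespace RationalMapFibers

open MvPolynomial LinearAlgebra.Projectivization

section HomogeneousFactors

variable {σ R : Type*} [CommRing R]

/-- The homomorphism `R[X] → R[X][t]`, `X_i ↦ X_i t`, whose `t ^ n`-coefficient is the
homogeneous component of degree `n`. -/
noncomputable def gradingHom (σ R : Type*) [CommRing R] :
    MvPolynomial σ R →ₐ[R] Polynomial (MvPolynomial σ R) :=
  aeval fun i => Polynomial.C (X i) * Polynomial.X

theorem gradingHom_monomial (m : σ →₀ ℕ) (r : R) :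
    gradingHom σ R (monomial m r) = Polynomial.C (monomial m r) * Polynomial.X ^ m.degree := by
  rw [gradingHom, aeval_monomial, monomial_eq, Finsupp.prod, Finsupp.prod]
  simp only [mul_pow, Finset.prod_mul_distrib, Finset.prod_pow_eq_pow_sum, map_mul, map_prod,
    map_pow, Finsupp.degree_apply, mul_assoc]
  rfl

theorem coeff_gradingHom (a : MvPolynomial σ R) (n : ℕ) :
    (gradingHom σ R a).coeff n = homogeneousComponent n a := by
  induction a using MvPolynomial.induction_on' with
  | monomial m r =>
    rw [gradingHom_monomial, Polynomial.coeff_C_mul_X_pow,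
      homogeneousComponent_of_mem (isHomogeneous_monomial r rfl)]
  | add p q hp hq => rw [map_add, Polynomial.coeff_add, hp, hq, map_add]

theorem coeff_gradingHom_ne_zero {a : MvPolynomial σ R} {m : σ →₀ ℕ} (hm : coeff m a ≠ 0) :
    (gradingHom σ R a).coeff m.degree ≠ 0 := fun h => hm <| by
  simpa [coeff_gradingHom, coeff_homogeneousComponent] using congrArg (coeff m) h

theorem gradingHom_ne_zero {a : MvPolynomial σ R} (ha : a ≠ 0) : gradingHom σ R a ≠ 0 := by
  obtain ⟨m, hm⟩ := exists_coeff_ne_zero ha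
  exact fun h => coeff_gradingHom_ne_zero hm (by rw [h, Polynomial.coeff_zero])

theorem isHomogeneous_of_natDegree_gradingHom_le {a : MvPolynomial σ R}
    (h : (gradingHom σ R a).natDegree ≤ (gradingHom σ R a).natTrailingDegree) :
    a.IsHomogeneous (gradingHom σ R a).natDegree := fun m hm => by
  have hm' := coeff_gradingHom_ne_zero hm
  refine (DFunLike.congr_fun Finsupp.degree_eq_weight_one m).symm.trans ?_
  exact (Polynomial.le_natDegree_of_ne_zero hm').antisymm
    (h.trans (Polynomial.natTrailingDegree_le_of_ne_zero hm'))

theorem isHomogeneous_of_dvd [IsDomain R] {a c : MvPolynomial σ R} {n : ℕ}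
    (hc : c.IsHomogeneous n) (hc0 : c ≠ 0) (hac : a ∣ c) : a.IsHomogeneous a.totalDegree := by
  obtain ⟨b, rfl⟩ := hac
  have ha := gradingHom_ne_zero (left_ne_zero_of_mul hc0)
  have hb := gradingHom_ne_zero (right_ne_zero_of_mul hc0)
  have hab : gradingHom σ R a * gradingHom σ R b = Polynomial.monomial n (a * b) := by
    ext1 i
    rw [← map_mul, coeff_gradingHom, Polynomial.coeff_monomial, homogeneousComponent_of_mem hc]
    simp only [eq_comm]
  have htop := congrArg Polynomial.natDegree hab
  have hbot := congrArg Polynomial.natTrailingDegree hab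
  rw [Polynomial.natDegree_mul ha hb, Polynomial.natDegree_monomial_eq _ hc0] at htop
  rw [Polynomial.natTrailingDegree_mul ha hb, Polynomial.natTrailingDegree_monomial hc0] at hbot
  have hb_le := Polynomial.natTrailingDegree_le_natDegree (gradingHom σ R b)
  have hom := isHomogeneous_of_natDegree_gradingHom_le (a := a) (by omega)
  rwa [hom.totalDegree (left_ne_zero_of_mul hc0)]

theorem totalDegree_prod_of_isDomain [IsDomain R] {ι : Type*} {S : Finset ι}
    {h : ι → MvPolynomial σ R} (h0 : ∀ y ∈ S, h y ≠ 0) :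
    (∏ y ∈ S, h y).totalDegree = ∑ y ∈ S, (h y).totalDegree := by
  classical
  induction S using Finset.induction_on with
  | empty => simp
  | insert a S ha ih =>
    rw [Finset.forall_mem_insert] at h0
    rw [Finset.prod_insert ha, Finset.sum_insert ha,
      totalDegree_mul_of_isDomain h0.1 (Finset.prod_ne_zero_iff.mpr h0.2), ih h0.2]

theorem totalDegree_pow_of_isDomain [IsDomain R] {a : MvPolynomial σ R} (ha : a ≠ 0) (n : ℕ) :
    (a ^ n).totalDegree = n * a.totalDegree := by
  simpa using totalDegree_prod_of_isDomain (S := Finset.range n) (h := fun _ => a) fun _ _ => ha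

end HomogeneousFactors

section Dimension

attribute [local instance] MvPolynomial.gradedAlgebra

variable {σ k : Type*} [Field k]

instance : QuasiSober (ProjectiveSpectrum (homogeneousSubmodule σ k)) :=
  inferInstanceAs (QuasiSober (AlgebraicGeometry.Proj (homogeneousSubmodule σ k)))

theorem asIdeal_lt_ker_constantCoeff (x : ProjectiveSpectrum (homogeneousSubmodule σ k)) :
    x.asHomogeneousIdeal.toIdeal < RingHom.ker (constantCoeff : MvPolynomial σ k →+* k) := by
  have decompose_zero (a : MvPolynomial σ k) :
      (DirectSum.decompose (homogeneousSubmodule σ k) a 0 : MvPolynomial σ k)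
        = C (constantCoeff a) :=
    (decomposition.decompose'_apply a 0).trans (homogeneousComponent_zero a)
  refine lt_of_le_not_ge (fun a ha => ?_) fun hle => x.not_irrelevant_le fun a ha => hle ?_
  · have hmem := x.asHomogeneousIdeal.isHomogeneous 0 ha
    rw [decompose_zero] at hmem
    by_contra h
    exact x.isPrime.ne_top (Ideal.eq_top_of_isUnit_mem _ hmem ((isUnit_iff_ne_zero.mpr h).map C))
  · exact C_eq_zero.mp ((decompose_zero a).symm.trans ha)

theorem genericPoint_specializes_genericPoint_iff {X : Type*} [TopologicalSpace X] [QuasiSober X]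
    {Z W : TopologicalSpace.IrreducibleCloseds X} :
    W.2.genericPoint ⤳ Z.2.genericPoint ↔ Z ≤ W := by
  rw [specializes_iff_closure_subset, Z.2.genericPoint_closure_eq, W.2.genericPoint_closure_eq,
    Z.3.closure_eq, W.3.closure_eq]
  rfl

theorem exists_primeSpectrum_lt_coheight {J : Ideal (MvPolynomial σ k)} {ℓ : ℕ}
    (h : ℓ ≤ topologicalKrullDim (ProjectiveSpectrum.zeroLocus (homogeneousSubmodule σ k)
      (J : Set (MvPolynomial σ k)))) :
    ∃ P : PrimeSpectrum (MvPolynomial σ k), J ≤ P.asIdeal ∧ ℓ + 1 ≤ Order.coheight P := by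
  have := (ProjectiveSpectrum.isClosed_zeroLocus (homogeneousSubmodule σ k)
    (J : Set (MvPolynomial σ k))).isClosedEmbedding_subtypeVal.quasiSober
  let irrelevant : PrimeSpectrum (MvPolynomial σ k) :=
    ⟨RingHom.ker (constantCoeff : MvPolynomial σ k →+* k), RingHom.ker_isPrime _⟩
  let genericPrime (Z : TopologicalSpace.IrreducibleCloseds
      (ProjectiveSpectrum.zeroLocus (homogeneousSubmodule σ k) (J : Set (MvPolynomial σ k)))) :
      (PrimeSpectrum (MvPolynomial σ k))ᵒᵈ :=
    OrderDual.toDual ⟨Z.2.genericPoint.1.asHomogeneousIdeal.toIdeal, Z.2.genericPoint.1.isPrime⟩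
  have hmono : StrictMono genericPrime := strictMono_of_le_iff_le fun Z W => by
    rw [← genericPoint_specializes_genericPoint_iff, subtype_specializes_iff,
      specializes_iff_mem_closure, ← ProjectiveSpectrum.le_iff_mem_closure]
    rfl
  obtain ⟨p, rfl⟩ := Order.le_krullDim_iff.mp h
  have hhead : OrderDual.toDual irrelevant < (p.map genericPrime hmono).head :=
    asIdeal_lt_ker_constantCoeff p.head.2.genericPoint.1
  have hlast : ((p.map genericPrime hmono).cons _ hhead).last = genericPrime p.last :=
    (RelSeries.last_cons ..).trans (p.last_map ..)
  refine ⟨OrderDual.ofDual (genericPrime p.last), p.last.2.genericPoint.2, ?_⟩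
  simpa using Order.length_le_height hlast.le

theorem height_add_le_card_of_le_topologicalKrullDim [Finite σ] {J : Ideal (MvPolynomial σ k)}
    {ℓ : ℕ} (h : ℓ ≤ topologicalKrullDim (ProjectiveSpectrum.zeroLocus (homogeneousSubmodule σ k)
      (J : Set (MvPolynomial σ k)))) : J.height + (ℓ + 1) ≤ Nat.card σ := by
  obtain ⟨P, hJP, hP⟩ := exists_primeSpectrum_lt_coheight h
  calc J.height + (ℓ + 1) ≤ Order.height P + Order.coheight P :=
        add_le_add ((Ideal.height_mono hJP).trans_eq P.height_eq_orderHeight) hP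
    _ ≤ Nat.card σ := by
      rw [← WithBot.coe_le_coe]
      calc (_ : WithBot ℕ∞) ≤ ringKrullDim (MvPolynomial σ k) := by
            rw [ringKrullDim, Order.krullDim_eq_iSup_height_add_coheight_of_nonempty]
            exact WithBot.coe_le_coe.mpr (le_iSup (fun P => Order.height P + Order.coheight P) P)
        _ = Nat.card σ := by
            rw [MvPolynomial.ringKrullDim_of_isNoetherianRing, ringKrullDim_eq_zero_of_field,
              zero_add]

end Dimension

section UnmixedPart

variable {R : Type*} [CommRing R] {J : Ideal R}

theorem mem_unmixedPart_iff {x : R} :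
    x ∈ unmixedPart J ↔ ∀ P : Ideal R, P.IsPrime → P ∈ J.minimalPrimes → P.height = J.height →
      ∃ s ∉ P, s * x ∈ J := by
  simp only [unmixedPart, Ideal.mem_iInf, Ideal.mem_comap]
  refine ⟨fun h P hP h1 h2 => ?_, fun h P => ?_⟩
  · exact (IsLocalization.algebraMap_mem_map_algebraMap_iff P.primeCompl
      (Localization.AtPrime P) J x).mp (h ⟨⟨P, hP⟩, h1, h2⟩)
  · exact (IsLocalization.algebraMap_mem_map_algebraMap_iff P.1.asIdeal.primeCompl
      (Localization.AtPrime P.1.asIdeal) J x).mpr (h _ P.1.isPrime P.2.1 P.2.2)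

theorem le_unmixedPart : J ≤ unmixedPart J := fun x hx =>
  mem_unmixedPart_iff.mpr fun P hP _ _ => ⟨1, P.ne_top_iff_one.mp hP.ne_top, by rwa [one_mul]⟩

theorem unmixedPart_ne_top (hJ : J.height ≠ ⊤) : unmixedPart J ≠ ⊤ := by
  obtain ⟨n, hn⟩ := ENat.ne_top_iff_exists.mp hJ
  obtain ⟨P, hP, hJP, hPn⟩ := Ideal.exists_isPrime_height_eq hn.symm
  have hfin : P.FiniteHeight := by simp [Ideal.finiteHeight_iff, hPn]
  have hmin := Ideal.mem_minimalPrimes_of_height_le hJP (hPn.trans hn).le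
  rw [Ideal.ne_top_iff_one, mem_unmixedPart_iff]
  intro h
  obtain ⟨s, hs, hsJ⟩ := h P hP hmin (hPn.trans hn)
  exact hs (hJP (by rwa [mul_one] at hsJ))

theorem unmixedPart_le_span_singleton [IsDomain R] [UniqueFactorizationMonoid R]
    [IsNoetherianRing R] (hJ : J.height = 1) {g : R} (hg : J ≤ Ideal.span {g}) (hg0 : g ≠ 0) :
    unmixedPart J ≤ Ideal.span {g} := fun x hx => by
  obtain ⟨g', x', c, hrel, rfl, rfl⟩ := UniqueFactorizationMonoid.exists_reduced_factors g hg0 x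
  have hc := left_ne_zero_of_mul hg0
  suffices hu : IsUnit g' from Ideal.mem_span_singleton.mpr (mul_dvd_mul_left c hu.dvd)
  by_contra hnu
  obtain ⟨q, hqi, hqg⟩ := WfDvdMonoid.exists_irreducible_factor hnu (right_ne_zero_of_mul hg0)
  have hq := hqi.prime
  have hP := (Ideal.span_singleton_prime hq.ne_zero).mpr hq
  have hheight : (Ideal.span {q}).height = J.height := hJ ▸
    Ideal.height_span_singleton_eq_one_of_mem_nonZeroDivisors
      (mem_nonZeroDivisors_of_ne_zero hq.ne_zero) hq.not_isUnit
  have hle : J ≤ Ideal.span {q} :=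
    hg.trans (Ideal.span_singleton_le_span_singleton.mpr (hqg.mul_left c))
  obtain ⟨s, hs, hsx⟩ := mem_unmixedPart_iff.mp hx _ hP
    (Ideal.mem_minimalPrimes_of_height_le hle hheight.le) hheight
  have hdvd := Ideal.mem_span_singleton.mp (hg hsx)
  rw [mul_left_comm, mul_dvd_mul_iff_left hc] at hdvd
  rcases hq.dvd_mul.mp (hqg.trans hdvd) with h | h
  · exact hs (Ideal.mem_span_singleton.mpr h)
  · exact hq.not_isUnit (hrel hqg h)

theorem exists_eq_mul_forall_dvd_isUnit [IsDomain R] [UniqueFactorizationMonoid R] {ι : Type*}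
    [Finite ι] [Nonempty ι] (f : ι → R) :
    ∃ (g : R) (f' : ι → R), (∀ i, f i = g * f' i) ∧ ∀ c, (∀ i, c ∣ f' i) → IsUnit c := by
  cases nonempty_fintype ι
  obtain ⟨_⟩ := (inferInstance : Nonempty (NormalizedGCDMonoid R))
  obtain ⟨f', hf', hgcd⟩ := Finset.univ.extract_gcd f Finset.univ_nonempty
  exact ⟨_, f', fun i => hf' i (Finset.mem_univ i), fun c hc =>
    isUnit_of_dvd_one (hgcd ▸ Finset.dvd_gcd fun i _ => hc i)⟩

theorem exists_span_singleton_eq_unmixedPart [IsDomain R] [UniqueFactorizationMonoid R]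
    [IsNoetherianRing R] (hJ : J.height = 1) : ∃ g : R, Ideal.span {g} = unmixedPart J := by
  have hJ0 := Ideal.ne_bot_of_height_eq_one hJ
  obtain ⟨n, s, hs⟩ := Submodule.fg_iff_exists_fin_generating_family.mp (IsNoetherian.noetherian J)
  have hn : Nonempty (Fin n) := by
    by_contra hn
    rw [not_nonempty_iff] at hn
    exact hJ0 (by rw [← hs, Set.range_eq_empty, Submodule.span_empty])
  have hsJ (i) : s i ∈ J := hs ▸ Submodule.subset_span (Set.mem_range_self i)
  obtain ⟨g, s', hgs, hs'⟩ := exists_eq_mul_forall_dvd_isUnit s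
  have hJg : J ≤ Ideal.span {g} := hs ▸ Submodule.span_le.mpr (Set.range_subset_iff.mpr fun i =>
    Ideal.mem_span_singleton.mpr ⟨s' i, hgs i⟩)
  have hg0 : g ≠ 0 := fun h => hJ0 (le_bot_iff.mp (by simpa [h] using hJg))
  refine ⟨g, le_antisymm ?_ (unmixedPart_le_span_singleton hJ hJg hg0)⟩
  rw [Ideal.span_singleton_le_iff_mem, mem_unmixedPart_iff]
  intro P hP _ hheight
  obtain ⟨i, hi⟩ : ∃ i, s' i ∉ P := by
    by_contra! hmem
    obtain ⟨q, hqP, hq⟩ :=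
      hP.exists_mem_prime_of_ne_bot (Ideal.ne_bot_of_height_eq_one (hheight.trans hJ))
    rw [Ideal.eq_span_singleton_of_height_eq_one (hheight.trans hJ) hqP hq] at hmem
    exact hq.not_isUnit (hs' q fun i => Ideal.mem_span_singleton.mp (hmem i))
  exact ⟨s' i, hi, by rw [mul_comm, ← hgs]; exact hsJ i⟩

end UnmixedPart

section FiberIdeal

variable {k σ ι : Type*} [Field k] {f : ι → MvPolynomial σ k} {y z : ℙ k (ι → k)}

theorem mem_fiberIdeal_of_mul_eq_mul (y : ℙ k (ι → k)) {a b : MvPolynomial σ k} {i j : ι}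
    (h : a * f i = b * f j) : C (y.rep i) * a - C (y.rep j) * b ∈ fiberIdeal f y := by
  have hy : fiberIdeal f y = specializedIdeal f y.rep := by
    conv_lhs => rw [← y.mk_rep]
    rfl
  have hG : C a * X i - C b * X j ∈ reesIdeal f := by
    rw [reesIdeal, RingHom.mem_ker]
    simp only [map_sub, map_mul, aeval_X, ← algebraMap_eq, AlgHom.commutes,
      Polynomial.algebraMap_apply, Algebra.algebraMap_self, RingHom.id_apply]
    rw [← mul_assoc, ← mul_assoc, ← Polynomial.C_mul, ← Polynomial.C_mul, h, sub_self]
  rw [hy]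
  convert! Ideal.mem_map_of_mem (specialize y.rep) hG using 1
  simp only [specialize, map_sub, map_mul, eval_C, eval_X, mul_comm]

theorem exists_rep_ne_zero (y : ℙ k (ι → k)) : ∃ i, y.rep i ≠ 0 :=
  Function.ne_iff.mp y.rep_nonzero

theorem exists_rep_mul_rep_ne (h : y ≠ z) : ∃ i j, y.rep i * z.rep j ≠ y.rep j * z.rep i := by
  by_contra! hcon
  obtain ⟨i, hi⟩ := exists_rep_ne_zero z
  refine h ?_
  rw [← y.mk_rep, ← z.mk_rep, Projectivization.mk_eq_mk_iff']
  refine ⟨y.rep i / z.rep i, funext fun j => ?_⟩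
  rw [Pi.smul_apply, smul_eq_mul, div_mul_eq_mul_div, hcon, mul_div_cancel_right₀ _ hi]

theorem isUnit_of_fiberIdeal_le_span_singleton [Finite ι] (hyz : y ≠ z) {c : MvPolynomial σ k}
    (hy : fiberIdeal f y ≤ Ideal.span {c}) (hz : fiberIdeal f z ≤ Ideal.span {c}) : IsUnit c := by
  have : Nonempty ι := (exists_rep_ne_zero y).nonempty
  obtain ⟨G, f', hf, hf'⟩ := exists_eq_mul_forall_dvd_isUnit f
  have hdvd {x : ℙ k (ι → k)} (hx : fiberIdeal f x ≤ Ideal.span {c}) (i j : ι) :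
      c ∣ C (x.rep i) * f' j - C (x.rep j) * f' i :=
    Ideal.mem_span_singleton.mp (hx (mem_fiberIdeal_of_mul_eq_mul x (by rw [hf, hf]; ring)))
  obtain ⟨i, j, hij⟩ := exists_rep_mul_rep_ne hyz
  refine hf' c fun l => ?_
  have hplucker : C (y.rep i * z.rep j - y.rep j * z.rep i) * f' l =
      C (z.rep j) * (C (y.rep i) * f' l - C (y.rep l) * f' i) -
      C (z.rep i) * (C (y.rep j) * f' l - C (y.rep l) * f' j) -
      C (y.rep l) * (C (z.rep i) * f' j - C (z.rep j) * f' i) := by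
    simp only [map_sub, map_mul]
    ring
  have hunit : IsUnit (C (y.rep i * z.rep j - y.rep j * z.rep i) : MvPolynomial σ k) :=
    (isUnit_iff_ne_zero.mpr (sub_ne_zero.mpr hij)).map C
  rw [← hunit.dvd_mul_left, hplucker]
  exact (((hdvd hy i l).mul_left _).sub ((hdvd hy j l).mul_left _)).sub ((hdvd hz i j).mul_left _)

theorem isRelPrime_of_fiberIdeal_le_span_singleton [Finite ι] (hyz : y ≠ z)
    {g h : MvPolynomial σ k} (hg : fiberIdeal f y ≤ Ideal.span {g})
    (hh : fiberIdeal f z ≤ Ideal.span {h}) : IsRelPrime g h := fun _ hcg hch =>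
  isUnit_of_fiberIdeal_le_span_singleton hyz
    (hg.trans (Ideal.span_singleton_le_span_singleton.mpr hcg))
    (hh.trans (Ideal.span_singleton_le_span_singleton.mpr hch))

theorem exists_eq_C_mul_add_mul {h : MvPolynomial σ k}
    (hh : fiberIdeal f y ≤ Ideal.span {h}) :
    ∃ (m : ι) (c : ι → k) (g : ι → MvPolynomial σ k), ∀ l, f l = C (c l) * f m + h * g l := by
  obtain ⟨m, hm⟩ := exists_rep_ne_zero y
  have hdvd (l : ι) : h ∣ C (y.rep m) * f l - C (y.rep l) * f m :=
    Ideal.mem_span_singleton.mp (hh (mem_fiberIdeal_of_mul_eq_mul y (mul_comm _ _)))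
  choose g hg using hdvd
  refine ⟨m, fun l => (y.rep m)⁻¹ * y.rep l, fun l => C (y.rep m)⁻¹ * g l, fun l => ?_⟩
  have hinv : C (y.rep m)⁻¹ * C (y.rep m) = (1 : MvPolynomial σ k) := by
    rw [← C_mul, inv_mul_cancel₀ hm, C_1]
  rw [C_mul]
  linear_combination C (y.rep m)⁻¹ * hg l - f l * hinv

theorem IsMinimalGeneratingSet.linearIndependent (hmin : IsMinimalGeneratingSet f) :
    LinearIndependent k f :=
  linearIndependent_iff_notMem_span.mpr fun i hi => hmin i <| by
    rw [← Set.compl_eq_univ_sdiff] at hi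
    exact Submodule.span_le_restrictScalars k (MvPolynomial σ k) _ hi

theorem exists_isHomogeneous_mem_fiberIdeal [Nontrivial ι] {d : ℕ}
    (hf : ∀ i, (f i).IsHomogeneous d) (hli : LinearIndependent k f) (y : ℙ k (ι → k)) :
    ∃ a ∈ fiberIdeal f y, a ≠ 0 ∧ a.IsHomogeneous d := by
  obtain ⟨i, hi⟩ := exists_rep_ne_zero y
  obtain ⟨j, hj⟩ := exists_ne i
  refine ⟨_, mem_fiberIdeal_of_mul_eq_mul y (mul_comm (f j) (f i)), fun h => hi ?_,
    ((hf j).C_mul _).sub ((hf i).C_mul _)⟩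
  simp only [C_mul', sub_eq_add_neg, ← neg_smul] at h
  exact ((LinearIndepOn.pair_iff f hj).mp (hli.linearIndepOn _) _ _ h).1

end FiberIdeal

section UnmixedEquation

variable {k σ ι : Type*} [Field k] {f : ι → MvPolynomial σ k} {d ℓ : ℕ} {y : ℙ k (ι → k)}
  {h : MvPolynomial σ k}

theorem height_fiberIdeal_eq_one [Finite σ] [Nontrivial ι] (hf : ∀ i, (f i).IsHomogeneous d)
    (hli : LinearIndependent k f) (hσ : Nat.card σ = ℓ + 2) (hy : y ∈ pointsWithFiberDim f ℓ) :
    (fiberIdeal f y).height = 1 := by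
  have hle := height_add_le_card_of_le_topologicalKrullDim hy.ge
  obtain ⟨a, ha, ha0, -⟩ := exists_isHomogeneous_mem_fiberIdeal hf hli y
  refine le_antisymm ?_ (Order.one_le_iff_ne_zero.mpr fun h0 => ha0 ?_)
  · rw [hσ, show ((ℓ + 2 : ℕ) : ℕ∞) = 1 + (ℓ + 1) by push_cast; ring] at hle
    exact (ENat.add_le_add_iff_right (ENat.natCast_ne_top (ℓ + 1))).mp hle
  · rwa [Ideal.height_eq_zero_iff_eq_bot.mp h0, Ideal.mem_bot] at ha

theorem exists_isUnmixedEquation [Finite σ] (hy : (fiberIdeal f y).height = 1) :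
    ∃ h, IsUnmixedEquation f y h :=
  exists_span_singleton_eq_unmixedPart hy

theorem IsUnmixedEquation.fiberIdeal_le (hh : IsUnmixedEquation f y h) :
    fiberIdeal f y ≤ Ideal.span {h} :=
  le_unmixedPart.trans_eq hh.symm

theorem IsUnmixedEquation.ne_zero_and_isHomogeneous [Nontrivial ι]
    (hf : ∀ i, (f i).IsHomogeneous d) (hli : LinearIndependent k f)
    (hh : IsUnmixedEquation f y h) : h ≠ 0 ∧ h.IsHomogeneous h.totalDegree := by
  obtain ⟨a, ha, ha0, hhom⟩ := exists_isHomogeneous_mem_fiberIdeal hf hli y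
  have hdvd := Ideal.mem_span_singleton.mp (hh.fiberIdeal_le ha)
  exact ⟨ne_zero_of_dvd_ne_zero ha0 hdvd, isHomogeneous_of_dvd hhom ha0 hdvd⟩

theorem IsUnmixedEquation.totalDegree_pos (hh : IsUnmixedEquation f y h) (h0 : h ≠ 0)
    (hheight : (fiberIdeal f y).height = 1) : 0 < h.totalDegree := by
  refine Nat.pos_of_ne_zero fun hdeg => ?_
  rw [totalDegree_eq_zero_iff_eq_C] at hdeg
  refine unmixedPart_ne_top (J := fiberIdeal f y) (by simp [hheight]) ?_
  rw [← hh, Ideal.span_singleton_eq_top, hdeg]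
  exact (isUnit_iff_ne_zero.mpr fun hc => h0 (by rw [hdeg, hc, C_0])).map C

end UnmixedEquation

section Determinants

variable {R : Type*} [CommRing R]

theorem pow_card_dvd_pow_card_mul_det {m n : Type*} [Fintype m] [Fintype n]
    [DecidableEq n] (A : Matrix n m R) (B : Matrix m n R) (N : Matrix n n R) (h : R) :
    h ^ Fintype.card n ∣ h ^ Fintype.card m * (A * B + h • N).det := by
  classical
  have hscale : Matrix.fromBlocks (h • N) A (-B) 1 * Matrix.fromBlocks 1 0 0 (h • 1) =
      Matrix.fromBlocks (h • 1) 0 0 1 * Matrix.fromBlocks N A (-B) (h • 1) := by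
    simp [Matrix.fromBlocks_multiply]
  have hdet := congrArg Matrix.det hscale
  simp only [Matrix.det_mul, Matrix.det_fromBlocks_one₂₂, Matrix.det_fromBlocks_zero₁₂,
    Matrix.det_smul, Matrix.det_one, mul_one, one_mul, Matrix.mul_zero, sub_zero,
    Matrix.mul_neg, sub_neg_eq_add] at hdet
  exact ⟨_, by rw [← hdet, mul_comm, add_comm]⟩

theorem pow_dvd_det_mul_add_smul [IsDomain R] {m n : Type*} [Fintype m] [Fintype n]
    [DecidableEq n] {ℓ : ℕ} (hcard : Fintype.card n = Fintype.card m + ℓ) (A : Matrix n m R)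
    (B : Matrix m n R) (N : Matrix n n R) {h : R} (h0 : h ≠ 0) :
    h ^ ℓ ∣ (A * B + h • N).det := by
  have := pow_card_dvd_pow_card_mul_det A B N h
  rwa [hcard, pow_add, mul_dvd_mul_iff_left (pow_ne_zero _ h0)] at this

/-- The maximal minor of an `(n + 1) × n` matrix obtained by deleting row `i`, with its sign in
the Hilbert-Burch relation `∑ i, signedMinor M i * M i j = 0`. -/
def signedMinor {n : ℕ} (M : Matrix (Fin (n + 1)) (Fin n) R) (i : Fin (n + 1)) : R :=
  (-1) ^ (i : ℕ) * (M.submatrix i.succAbove id).det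

theorem sum_signedMinor_mul {n : ℕ} (M : Matrix (Fin (n + 1)) (Fin n) R) (j : Fin n) :
    ∑ i, signedMinor M i * M i j = 0 := by
  let N : Matrix (Fin (n + 1)) (Fin (n + 1)) R :=
    Matrix.of fun i => Fin.cons (M i j) (M i)
  have hN : N.det = 0 := Matrix.det_zero_of_column_eq (Fin.succ_ne_zero j).symm fun i => by simp [N]
  rw [Matrix.det_succ_column_zero] at hN
  rw [← hN]
  refine Finset.sum_congr rfl fun i _ => ?_
  rw [signedMinor, mul_right_comm]
  rfl

theorem exists_signedMinor_ne_zero {n : ℕ} {M : Matrix (Fin (n + 1)) (Fin n) R}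
    (hM : minorsIdeal n M ≠ ⊥) : ∃ i, signedMinor M i ≠ 0 := by
  by_contra! hcon
  refine hM (Ideal.span_eq_bot.mpr ?_)
  rintro _ ⟨⟨r, c⟩, rfl⟩
  obtain ⟨i, hi⟩ : ∃ i, i ∉ Set.range r := by
    by_contra! hsurj
    simpa using Fintype.card_le_of_surjective r hsurj
  choose s hs using fun a => Fin.exists_succAbove_eq fun h : r a = i => hi ⟨a, h⟩
  have hs_inj : Function.Injective s := fun a b hab =>
    r.injective ((hs a).symm.trans ((congrArg i.succAbove hab).trans (hs b)))
  have hsub : M.submatrix r c = ((M.submatrix i.succAbove id).submatrix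
      (Function.Embedding.mk s hs_inj).equivOfFiniteSelfEmbedding id).submatrix id
      c.equivOfFiniteSelfEmbedding := by
    ext a b
    exact congrFun (congrArg M (hs a).symm) (c b)
  have hdet : (M.submatrix i.succAbove id).det = 0 := by
    simpa [signedMinor, (isUnit_one.neg.pow _).mul_right_eq_zero] using hcon i
  simp only [hsub, Matrix.det_permute', Matrix.det_permute, hdet, mul_zero]

theorem isHomogeneous_det {σ m : Type*} [Fintype m] [DecidableEq m]
    {e : ℕ} {N : Matrix m m (MvPolynomial σ R)} (hN : ∀ i j, (N i j).IsHomogeneous e) :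
    N.det.IsHomogeneous (Fintype.card m * e) := by
  rw [Matrix.det_apply]
  refine IsHomogeneous.sum _ _ _ fun s _ => ?_
  have hprod := IsHomogeneous.prod Finset.univ (fun i => N (s i) i) (fun _ => e) fun i _ => hN _ _
  rw [Finset.sum_const, Finset.card_univ, smul_eq_mul] at hprod
  rcases Int.units_eq_one_or (Equiv.Perm.sign s) with hs | hs
  · rwa [hs, one_smul]
  · rw [hs, Units.neg_smul, one_smul]
    exact hprod.neg

end Determinants

section Jacobian

variable {k σ ι : Type*} [Field k] {f : ι → MvPolynomial σ k} {ℓ : ℕ} {y : ℙ k (ι → k)}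
  {h : MvPolynomial σ k}

theorem pow_dvd_det_submatrix_jacobian {m : Type*} [Fintype m] [DecidableEq m]
    (hm : Fintype.card m = ℓ + 2) (hh : fiberIdeal f y ≤ Ideal.span {h}) (h0 : h ≠ 0)
    (r : m → ι) (c : m → σ) : h ^ ℓ ∣ ((jacobian f).submatrix r c).det := by
  obtain ⟨l, a, g, hfg⟩ := exists_eq_C_mul_add_mul hh
  have hrank : (jacobian f).submatrix r c =
      (Matrix.of fun i => ![C (a (r i)), g (r i)]) *
        Matrix.of ![fun j => pderiv (c j) (f l), fun j => pderiv (c j) h] +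
      h • Matrix.of fun i j => pderiv (c j) (g (r i)) := by
    ext1 i j
    have hpderiv := congrArg (pderiv (c j)) (hfg (r i))
    simp only [map_add, pderiv_mul, pderiv_C, zero_mul, zero_add] at hpderiv
    simp only [jacobian, Matrix.submatrix_apply, Matrix.of_apply, Matrix.add_apply,
      Matrix.mul_apply, Fin.sum_univ_two, Matrix.smul_apply, Matrix.cons_val_zero,
      Matrix.cons_val_one, smul_eq_mul, hpderiv]
    ring
  rw [hrank]
  exact pow_dvd_det_mul_add_smul (by rw [hm, Fintype.card_fin, add_comm]) _ _ _ h0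

end Jacobian

section SignedMinors

variable {k : Type*} [Field k] {d n : ℕ} {f : Fin (n + 1) → MvPolynomial (Fin n) k}

theorem isHomogeneous_signedMinor_jacobian (hf : ∀ i, (f i).IsHomogeneous d) (i : Fin (n + 1)) :
    (signedMinor (jacobian f) i).IsHomogeneous (n * (d - 1)) := by
  have hdet : ((jacobian f).submatrix i.succAbove id).det.IsHomogeneous (n * (d - 1)) := by
    simpa using isHomogeneous_det (N := (jacobian f).submatrix i.succAbove id)
      fun a b => (hf _).pderiv
  rw [signedMinor]
  rcases neg_one_pow_eq_or (MvPolynomial (Fin n) k) (i : ℕ) with h | h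
  · rwa [h, one_mul]
  · rw [h, neg_one_mul]
    exact hdet.neg

theorem natCast_ne_zero_of_signedMinor_jacobian_ne_zero [NeZero n]
    (hf : ∀ i, (f i).IsHomogeneous d) {i : Fin (n + 1)} (hi : signedMinor (jacobian f) i ≠ 0) :
    (d : k) ≠ 0 := fun hd => by
  have hdet : ((jacobian f).submatrix i.succAbove id).det = 0 :=
    Matrix.exists_mulVec_eq_zero_iff.mp
      ⟨X, fun hX => X_ne_zero 0 (congrFun hX 0), funext fun a => by
        have heuler := (hf (i.succAbove a)).sum_X_mul_pderiv
        rw [nsmul_eq_mul, ← map_natCast C d, hd, C_0, zero_mul] at heuler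
        exact (Finset.sum_congr rfl fun j _ => mul_comm _ _).trans heuler⟩
  exact hi (by rw [signedMinor, hdet, mul_zero])

theorem sum_signedMinor_jacobian_mul (hf : ∀ i, (f i).IsHomogeneous d) (hd : (d : k) ≠ 0) :
    ∑ i, signedMinor (jacobian f) i * f i = 0 := by
  have hd' : (C (d : k) : MvPolynomial (Fin n) k) ≠ 0 := C_ne_zero.mpr hd
  have heuler (i) : C (d : k) * f i = ∑ j, X j * pderiv j (f i) := by
    rw [(hf i).sum_X_mul_pderiv, nsmul_eq_mul, map_natCast]
  refine (mul_eq_zero.mp ?_).resolve_left hd'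
  calc C (d : k) * ∑ i, signedMinor (jacobian f) i * f i
      = ∑ i, ∑ j, X j * (signedMinor (jacobian f) i * jacobian f i j) := by
        simp_rw [Finset.mul_sum, mul_left_comm (C (d : k)), heuler, Finset.mul_sum,
          mul_left_comm _ (X _)]
        rfl
    _ = ∑ j, X j * ∑ i, signedMinor (jacobian f) i * jacobian f i j := by
        rw [Finset.sum_comm]
        simp_rw [Finset.mul_sum]
    _ = 0 := Finset.sum_eq_zero fun j _ => by rw [sum_signedMinor_mul, mul_zero]

end SignedMinors

section Syzygies

variable {k σ ι : Type*} [Field k] [Fintype ι] {f : ι → MvPolynomial σ k}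

theorem mem_syzygyPart_iff {ν : ℕ} {a : ι → MvPolynomial σ k} :
    a ∈ syzygyPart f ν ↔ ∑ i, a i * f i = 0 ∧ ∀ i, (a i).IsHomogeneous ν := by
  simp [syzygyPart, Fintype.linearCombination_apply, Submodule.mem_pi]

theorem indeg_syzygyPart_le {ν : ℕ} {a : ι → MvPolynomial σ k} (ha : a ∈ syzygyPart f ν)
    (h0 : a ≠ 0) : indeg (syzygyPart f) ≤ ν :=
  iInf₂_le ν fun h => h0 (by rwa [h, Submodule.mem_bot] at ha)

theorem indeg_syzygyPart_ne_zero (hli : LinearIndependent k f) :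
    indeg (syzygyPart f) ≠ 0 := by
  refine (Order.one_le_iff_pos.mp (le_iInf₂ fun ν hν => ?_)).ne'
  rw [← Nat.cast_one, Nat.cast_le, Nat.one_le_iff_ne_zero]
  rintro rfl
  refine hν ((Submodule.eq_bot_iff _).mpr fun a ha => ?_)
  obtain ⟨hsum, hhom⟩ := mem_syzygyPart_iff.mp ha
  have hconst (i) : a i = C (coeff 0 (a i)) :=
    totalDegree_eq_zero_iff_eq_C.mp (Nat.le_zero.mp (hhom i).totalDegree_le)
  have hcoeff := Fintype.linearIndependent_iff.mp hli (fun i => coeff 0 (a i)) <| by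
    simpa only [← C_mul', ← hconst] using hsum
  funext i
  rw [hconst, hcoeff, C_0, Pi.zero_apply]

theorem totalDegree_add_indeg_syzygyPart_le {H : MvPolynomial σ k} {b : ι → MvPolynomial σ k}
    {e : ℕ} (hb : b ∈ syzygyPart f e) (hb0 : b ≠ 0) (hH : ∀ i, H ∣ b i) :
    H.totalDegree + indeg (syzygyPart f) ≤ e := by
  obtain ⟨hsum, hhom⟩ := mem_syzygyPart_iff.mp hb
  choose a ha using hH
  obtain ⟨m, hm⟩ := Function.ne_iff.mp hb0
  have hH0 : H ≠ 0 := left_ne_zero_of_mul (ha m ▸ hm)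
  have hdeg {i} (hi : b i ≠ 0) : H.totalDegree + (a i).totalDegree = e := by
    rw [← (hhom i).totalDegree hi, ha, totalDegree_mul_of_isDomain hH0]
    exact right_ne_zero_of_mul (ha i ▸ hi)
  have hmem : a ∈ syzygyPart f (a m).totalDegree := by
    refine mem_syzygyPart_iff.mpr ⟨(mul_eq_zero.mp ?_).resolve_left hH0, fun i => ?_⟩
    · simpa only [Finset.mul_sum, ← mul_assoc, ← ha] using hsum
    · by_cases hi : b i = 0
      · rw [(mul_eq_zero.mp ((ha i).symm.trans hi)).resolve_left hH0]
        exact isHomogeneous_zero _ _ _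
      · rw [show (a m).totalDegree = (a i).totalDegree from
          Nat.add_left_cancel ((hdeg hm).trans (hdeg hi).symm)]
        exact isHomogeneous_of_dvd (hhom i) hi (ha i ▸ dvd_mul_left _ _)
  rw [← hdeg hm, Nat.cast_add]
  gcongr
  exact indeg_syzygyPart_le hmem fun h0 => hm (by rw [ha, h0, Pi.zero_apply, mul_zero])

end Syzygies

section DegreeBound

variable {k : Type*} [Field k] {d ℓ : ℕ} {f : Fin (ℓ + 3) → MvPolynomial (Fin (ℓ + 2)) k}

theorem mul_sum_totalDegree_add_indeg_le (hf : ∀ i, (f i).IsHomogeneous d)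
    (hJ : minorsIdeal (ℓ + 2) (jacobian f) ≠ ⊥) {S : Finset (ℙ k (Fin (ℓ + 3) → k))}
    {h : ℙ k (Fin (ℓ + 3) → k) → MvPolynomial (Fin (ℓ + 2)) k} (h0 : ∀ y ∈ S, h y ≠ 0)
    (hh : ∀ y ∈ S, fiberIdeal f y ≤ Ideal.span {h y}) :
    (ℓ * ∑ y ∈ S, (h y).totalDegree : ℕ) + indeg (syzygyPart f) ≤ ((ℓ + 2) * (d - 1) : ℕ) := by
  obtain ⟨m, hm⟩ := exists_signedMinor_ne_zero hJ
  have hsyz : signedMinor (jacobian f) ∈ syzygyPart f ((ℓ + 2) * (d - 1)) :=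
    mem_syzygyPart_iff.mpr ⟨sum_signedMinor_jacobian_mul hf
      (natCast_ne_zero_of_signedMinor_jacobian_ne_zero hf hm),
      isHomogeneous_signedMinor_jacobian hf⟩
  have hdvd (i) : ∏ y ∈ S, h y ^ ℓ ∣ signedMinor (jacobian f) i :=
    Finset.prod_dvd_of_isRelPrime
      (fun y hy z hz hyz =>
        (isRelPrime_of_fiberIdeal_le_span_singleton hyz (hh y hy) (hh z hz)).pow)
      fun y hy => (pow_dvd_det_submatrix_jacobian (by simp) (hh y hy) (h0 y hy) _ _).mul_left _
  have hdeg : (∏ y ∈ S, h y ^ ℓ).totalDegree = ℓ * ∑ y ∈ S, (h y).totalDegree := by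
    rw [totalDegree_prod_of_isDomain fun y hy => pow_ne_zero ℓ (h0 y hy), Finset.mul_sum]
    exact Finset.sum_congr rfl fun y hy => totalDegree_pow_of_isDomain (h0 y hy) ℓ
  rw [← hdeg]
  exact totalDegree_add_indeg_syzygyPart_le hsyz (Function.ne_iff.mpr ⟨m, hm⟩) hdvd

theorem indeg_syzygyPart_ne_top (hf : ∀ i, (f i).IsHomogeneous d)
    (hJ : minorsIdeal (ℓ + 2) (jacobian f) ≠ ⊥) : indeg (syzygyPart f) ≠ ⊤ :=
  ne_top_of_le_ne_top (ENat.natCast_ne_top _) <| le_add_self.trans <|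
    mul_sum_totalDegree_add_indeg_le hf hJ (S := ∅) (h := 0) (by simp) (by simp)

theorem one_le_degree_of_minorsIdeal_jacobian_ne_bot (hf : ∀ i, (f i).IsHomogeneous d)
    (hJ : minorsIdeal (ℓ + 2) (jacobian f) ≠ ⊥) : 1 ≤ d := by
  obtain ⟨i, hi⟩ := exists_signedMinor_ne_zero hJ
  refine Nat.pos_of_ne_zero fun hd => natCast_ne_zero_of_signedMinor_jacobian_ne_zero hf hi ?_
  rw [hd, Nat.cast_zero]

theorem finite_pointsWithFiberDim (hℓ : 1 ≤ ℓ) (hf : ∀ i, (f i).IsHomogeneous d)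
    (hli : LinearIndependent k f) (hJ : minorsIdeal (ℓ + 2) (jacobian f) ≠ ⊥) :
    (pointsWithFiberDim f ℓ).Finite := by
  by_contra hinf
  obtain ⟨S, hS, hcard⟩ := Set.Infinite.exists_subset_card_eq hinf ((ℓ + 2) * (d - 1) + 1)
  have hheight {y} (hy : y ∈ pointsWithFiberDim f ℓ) : (fiberIdeal f y).height = 1 :=
    height_fiberIdeal_eq_one hf hli (Nat.card_fin _) hy
  choose! h hh using fun y hy => exists_isUnmixedEquation (hheight (y := y) hy)
  have h0 (y) (hy : y ∈ S) : h y ≠ 0 := ((hh y (hS hy)).ne_zero_and_isHomogeneous hf hli).1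
  have hcard_le : S.card ≤ ∑ y ∈ S, (h y).totalDegree := by
    rw [Finset.card_eq_sum_ones]
    exact Finset.sum_le_sum fun y hy =>
      (hh y (hS hy)).totalDegree_pos (h0 y hy) (hheight (hS hy))
  have hle : ℓ * ∑ y ∈ S, (h y).totalDegree ≤ (ℓ + 2) * (d - 1) := Nat.cast_le.mp <|
    le_self_add.trans (mul_sum_totalDegree_add_indeg_le hf hJ h0 fun y hy =>
      (hh y (hS hy)).fiberIdeal_le)
  have hmul := Nat.le_mul_of_pos_left (∑ y ∈ S, (h y).totalDegree) hℓ
  lia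

end DegreeBound

end RationalMapFibers

open RationalMapFibers

theorem corollary4p4_general {k : Type*} [Field k] {ℓ d : ℕ} (hℓ : 1 ≤ ℓ)
    (f : Fin (ℓ + 3) → MvPolynomial (Fin (ℓ + 2)) k) (hf : ∀ i, (f i).IsHomogeneous d)
    (hmin : IsMinimalGeneratingSet f) (hJ : minorsIdeal (ℓ + 2) (jacobian f) ≠ ⊥) :
    ∃ hfin : (pointsWithFiberDim f ℓ).Finite,
      (∀ y ∈ pointsWithFiberDim f ℓ, ∃ (e : ℕ) (h : MvPolynomial (Fin (ℓ + 2)) k),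
        h ≠ 0 ∧ h.IsHomogeneous e ∧ IsUnmixedEquation f y h) ∧
      indeg (syzygyPart f) ≠ ⊤ ∧
      (∀ h : Projectivization k (Fin (ℓ + 3) → k) → MvPolynomial (Fin (ℓ + 2)) k,
        (∀ y ∈ pointsWithFiberDim f ℓ, IsUnmixedEquation f y (h y)) →
        ℓ * ((∑ y ∈ hfin.toFinset, (h y).totalDegree : ℕ) : ℤ) ≤
          (ℓ + 2) * ((d : ℤ) - 1) - ((indeg (syzygyPart f)).toNat : ℤ)) ∧
      (ℓ + 2) * ((d : ℤ) - 1) - ((indeg (syzygyPart f)).toNat : ℤ) <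
        (ℓ + 2) * ((d : ℤ) - 1) := by
  have hli := hmin.linearIndependent
  have hfin := finite_pointsWithFiberDim hℓ hf hli hJ
  have hd : 1 ≤ d := one_le_degree_of_minorsIdeal_jacobian_ne_bot hf hJ
  obtain ⟨ν, hν⟩ := ENat.ne_top_iff_exists.mp (indeg_syzygyPart_ne_top hf hJ)
  have hν0 : 0 < ν := by
    have := indeg_syzygyPart_ne_zero hli
    rwa [← hν, Nat.cast_ne_zero, ← Nat.pos_iff_ne_zero] at this
  refine ⟨hfin, fun y hy => ?_, hν ▸ ENat.natCast_ne_top ν, fun h hh => ?_, ?_⟩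
  · have hheight := height_fiberIdeal_eq_one hf hli (Nat.card_fin _) hy
    obtain ⟨h, hh⟩ := exists_isUnmixedEquation hheight
    have hprop := hh.ne_zero_and_isHomogeneous hf hli
    exact ⟨h.totalDegree, h, hprop.1, hprop.2, hh⟩
  · have hbound := mul_sum_totalDegree_add_indeg_le hf hJ (S := hfin.toFinset) (h := h)
      (fun y hy => ((hh y (hfin.mem_toFinset.mp hy)).ne_zero_and_isHomogeneous hf hli).1)
      fun y hy => (hh y (hfin.mem_toFinset.mp hy)).fiberIdeal_le
    rw [← hν, ← Nat.cast_add, Nat.cast_le] at hbound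
    rw [← hν, ENat.toNat_natCast, le_sub_iff_add_le, ← Nat.cast_one, ← Nat.cast_sub hd]
    exact_mod_cast hbound
  · rw [← hν, ENat.toNat_natCast]
    lia

theorem corollary4p4 {k : Type*} [Field k] [IsAlgClosed k] (d : ℕ)
    (f : Fin 4 → MvPolynomial (Fin 3) k) (hf : ∀ i, (f i).IsHomogeneous d)
    (hmin : IsMinimalGeneratingSet f) (hcodim : (baseIdeal f).height = 2)
    (hJ : minorsIdeal 3 (jacobian f) ≠ ⊥) (hd : ¬ ringChar k ∣ d) :
    ∃ hfin : (pointsWithFiberDim f 1).Finite,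
      (∀ y ∈ pointsWithFiberDim f 1, ∃ (e : ℕ) (h : MvPolynomial (Fin 3) k),
        h ≠ 0 ∧ h.IsHomogeneous e ∧ IsUnmixedEquation f y h) ∧
      indeg (syzygyPart f) ≠ ⊤ ∧
      (∀ h : Projectivization k (Fin 4 → k) → MvPolynomial (Fin 3) k,
        (∀ y ∈ pointsWithFiberDim f 1, IsUnmixedEquation f y (h y)) →
        ((∑ y ∈ hfin.toFinset, (h y).totalDegree : ℕ) : ℤ) ≤
          3 * ((d : ℤ) - 1) - ((indeg (syzygyPart f)).toNat : ℤ)) ∧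
      3 * ((d : ℤ) - 1) - ((indeg (syzygyPart f)).toNat : ℤ) < 3 * ((d : ℤ) - 1) := by
  simpa only [one_mul, Nat.cast_one, Int.reduceAdd] using corollary4p4_general le_rfl f hf hmin hJ
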